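/- For $n \ge 0$ let $STS(n)$ denote the number of (labelled) Steiner triple systems on a fixed set $V$ of $n$ vertices, i.e. the number of collections $T \subseteq \binom{V}{3}$ of triples such that each pair of distinct vertices of $V$ is contained in exactly one triple of $T$. Then $$STS(n) \le \left((1+o(1))\,\frac{n}{e^2}\right)^{n^2/6};$$ that is, there is a sequence of real numbers $\varepsilon_n > -1$ with $\varepsilon_n \to 0$ as $n \to \infty$ such that $STS(n) \le \left((1+\varepsilon_n)\, n/e^2\right)^{n^2/6}$ for every $n \ge 0$ (with $0^0 = 1$). -/

import Mathlib

open Filter Topology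

/-- A Steiner triple system on the vertex set `V`: a collection `T` of `3`-element subsets of `V`
such that each pair of distinct vertices is contained in exactly one member of `T`. -/
def IsSteinerTripleSystem {V : Type*} (T : Finset (Finset V)) : Prop :=
  (∀ t ∈ T, t.card = 3) ∧
    ∀ x y : V, x ≠ y → ∃! t : Finset V, t ∈ T ∧ x ∈ t ∧ y ∈ t

/-- The number of (labelled) Steiner triple systems on an `n`-element vertex set. -/
noncomputable def STS (n : ℕ) : ℕ :=
  Nat.card {T : Finset (Finset (Fin n)) // IsSteinerTripleSystem T}

/-! Build a system block by block, each time choosing uniformly among the triples that share no pair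
with the earlier blocks. An ordered system `(T, σ)` with `N = n(n-1)/6` blocks then has weight `∏
1/A_i`, where `A_i` counts the choices at step `i`, and all these weights sum to at most 1
(`sum_prod_prefix_weight_le_one`).

For fixed `T` and uniformly random `σ`, Jensen bounds the mean weight below by the product of the
reciprocals of any upper bounds on the means of the `A_i`. When `m` blocks remain, a block is
available with probability `m/N`. The pairs of a non-block triple lie in three different blocks, all
of which must still remain, so it is available with probability at most `(m/N)^3`. Hence the mean of
`A_i` is at most `m + C(n,3) m^3/N^3 ≤ m (1 + n m^2/N^2)`.

The factors `m` cancel the `N!` orderings, so the count is at most `∏ (1 + n m^2/N^2)`, which is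
`n^N (N!/N^N)^2`, about `(n/e^2)^N`, up to factors `e^{o(n^2)}`. -/

/-! ### Probabilistic tools: Kraft, random bijections, Jensen -/

open Finset in
/-- Kraft's inequality for sequences whose next entry is weighted according to the set of the
previous entries. -/
theorem sum_prod_prefix_weight_le_one {A : Type*} [Fintype A] [DecidableEq A]
    (g : Finset A → A → ℝ) (hg : ∀ R a, 0 ≤ g R a) (hg1 : ∀ R, ∑ a, g R a ≤ 1) (N : ℕ) :
    ∑ s : Fin N → A, ∏ i, g ((Iio i).image s) (s i) ≤ 1 := by
  induction N with
  | zero => simp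
  | succ N ih =>
    have key : ∀ (a : A) (s : Fin N → A),
        ∏ i, g ((Iio i).image (Fin.snoc (α := fun _ => A) s a))
          (Fin.snoc (α := fun _ => A) s a i) =
        (∏ i, g ((Iio i).image s) (s i)) * g (univ.image s) a := by
      intro a s
      rw [Fin.prod_univ_castSucc]
      congr 1
      · refine prod_congr rfl fun i _ => ?_
        congr 1
        · ext b
          simp only [mem_image, mem_Iio]
          constructor
          · rintro ⟨j, hj, rfl⟩
            obtain ⟨k, rfl⟩ := Fin.exists_castSucc_eq.2 (hj.trans (Fin.castSucc_lt_last i)).ne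
            exact ⟨k, by simpa using hj, by simp⟩
          · rintro ⟨j, hj, rfl⟩
            exact ⟨j.castSucc, by simpa using hj, by simp⟩
        · simp
      · congr 1
        · ext b
          simp only [mem_image, mem_Iio, mem_univ, true_and]
          constructor
          · rintro ⟨j, hj, rfl⟩
            obtain ⟨k, rfl⟩ := Fin.exists_castSucc_eq.2 hj.ne
            exact ⟨k, by simp⟩
          · rintro ⟨j, rfl⟩
            exact ⟨j.castSucc, Fin.castSucc_lt_last j, by simp⟩
        · simp
    rw [← (Fin.snocEquiv (fun _ : Fin (N + 1) => A)).sum_comp, Fintype.sum_prod_type_right]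
    simp only [Fin.snocEquiv, Equiv.coe_fn_mk, key]
    calc ∑ s : Fin N → A, ∑ a, (∏ i, g ((Iio i).image s) (s i)) * g (univ.image s) a
        ≤ ∑ s : Fin N → A, ∏ i, g ((Iio i).image s) (s i) := by
          refine sum_le_sum fun s _ => ?_
          rw [← mul_sum]
          exact mul_le_of_le_one_right (prod_nonneg fun i _ => hg _ _) (hg1 _)
      _ ≤ 1 := ih

theorem descFactorial_mul_pow_le {m N : ℕ} (h : m ≤ N) (k : ℕ) :
    m.descFactorial k * N ^ k ≤ m ^ k * N.descFactorial k := by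
  induction k with
  | zero => simp
  | succ k ih =>
    rw [Nat.descFactorial_succ, Nat.descFactorial_succ, pow_succ, pow_succ]
    have h1 : (m - k) * N ≤ m * (N - k) := by
      rw [Nat.sub_mul, Nat.mul_sub]
      have := Nat.mul_le_mul_right k h
      have h3 : m * k ≤ k * N := by rw [mul_comm k N]; exact this
      omega
    calc (m - k) * m.descFactorial k * (N ^ k * N)
        = ((m - k) * N) * (m.descFactorial k * N ^ k) := by ring
      _ ≤ (m * (N - k)) * (m ^ k * N.descFactorial k) := Nat.mul_le_mul h1 ih
      _ = _ := by ring

/-- For a uniformly random bijection `σ : α ≃ β`, the probability that `k` given elements all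
land in `M` is at most `(|M| / |β|) ^ k`. -/
theorem card_equiv_mapsTo_mul_pow_le {α β κ : Type*} [Fintype α] [Fintype β] [Fintype κ]
    [DecidableEq α] [DecidableEq β] (hαβ : Fintype.card α = Fintype.card β)
    (f : κ ↪ α) (M : Finset β) :
    (Finset.univ.filter fun σ : α ≃ β => ∀ k, σ (f k) ∈ M).card *
        Fintype.card β ^ Fintype.card κ ≤
      (Fintype.card β).factorial * M.card ^ Fintype.card κ := by
  classical
  set c : (κ ↪ α) → ℕ := fun f => (Finset.univ.filter fun σ : α ≃ β => ∀ k, σ (f k) ∈ M).card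
  -- Precomposing with a permutation that carries `f` to `f'` shows the count is the same for every
  -- embedding, so it can be averaged over all of them.
  have hinv : ∀ f' : κ ↪ α, c f' = c f := by
    intro f'
    obtain ⟨τ, hτ⟩ : ∃ τ : Equiv.Perm α, ∀ k, τ (f k) = f' k := by
      let e : Set.range f ≃ Set.range f' :=
        (Equiv.ofInjective f f.injective).symm.trans (Equiv.ofInjective f' f'.injective)
      refine ⟨e.extendSubtype, fun k => ?_⟩
      rw [Equiv.extendSubtype_apply_of_mem e (f k) ⟨k, rfl⟩]
      exact congrArg f' ((Equiv.ofInjective f f.injective).symm_apply_apply k)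
    refine Finset.card_bij (fun σ _ => τ.trans σ) ?_ ?_ ?_
    · intro σ hσ
      refine Finset.mem_filter.2 ⟨Finset.mem_univ _, fun k => ?_⟩
      rw [Equiv.trans_apply, hτ]
      exact (Finset.mem_filter.1 hσ).2 k
    · intro σ _ σ' _ h
      ext x
      have := Equiv.congr_fun h (τ.symm x)
      simpa using this
    · intro σ hσ
      refine ⟨τ.symm.trans σ, ?_, ?_⟩
      · refine Finset.mem_filter.2 ⟨Finset.mem_univ _, fun k => ?_⟩
        rw [Equiv.trans_apply, ← hτ, Equiv.symm_apply_apply]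
        exact (Finset.mem_filter.1 hσ).2 k
      · ext x; simp
  have hsum : ∑ f' : κ ↪ α, c f' =
      (Fintype.card β).factorial * M.card.descFactorial (Fintype.card κ) := by
    have h1 : ∀ σ : α ≃ β, (Finset.univ.filter fun f' : κ ↪ α => ∀ k, σ (f' k) ∈ M).card
        = M.card.descFactorial (Fintype.card κ) := by
      intro σ
      rw [← Fintype.card_coe M, ← Fintype.card_embedding_eq, ← Fintype.card_subtype]
      refine Fintype.card_congr (Equiv.mk
        (fun f' => (⟨fun k => ⟨σ (f'.1 k), f'.2 k⟩, fun a b h => f'.1.injective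
          (σ.injective (congrArg Subtype.val h))⟩ : κ ↪ M))
        (fun g => ⟨(⟨fun k => σ.symm (g k), fun a b h => g.injective
          (Subtype.ext (σ.symm.injective h))⟩ : κ ↪ α), fun k => ?_⟩) (fun f' => ?_) fun g => ?_)
      · have h : σ (σ.symm (g k)) ∈ M := by
          rw [Equiv.apply_symm_apply]
          exact (g k).2
        exact h
      · ext k
        exact σ.symm_apply_apply _
      · ext k
        exact σ.apply_symm_apply _
    have h2 : ∑ f' : κ ↪ α, c f' = ∑ σ : α ≃ β,
        (Finset.univ.filter fun f' : κ ↪ α => ∀ k, σ (f' k) ∈ M).card := by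
      simp only [c, Finset.card_filter]
      exact Finset.sum_comm
    rw [h2, Finset.sum_congr rfl fun σ _ => h1 σ, Finset.sum_const, smul_eq_mul,
      Finset.card_univ, Fintype.card_equiv (Fintype.equivOfCardEq hαβ), hαβ]
  rw [Finset.sum_congr rfl fun f' _ => hinv f', Finset.sum_const, smul_eq_mul, Finset.card_univ,
    Fintype.card_embedding_eq, hαβ] at hsum
  have hpos : 0 < (Fintype.card β).descFactorial (Fintype.card κ) := by
    rw [← hαβ, ← Fintype.card_embedding_eq]
    exact Fintype.card_pos_iff.2 ⟨f⟩
  refine Nat.le_of_mul_le_mul_left ?_ hpos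
  calc _ = ((Fintype.card β).descFactorial (Fintype.card κ) * c f) *
          Fintype.card β ^ Fintype.card κ := by ring
    _ = (Fintype.card β).factorial *
          (M.card.descFactorial (Fintype.card κ) * Fintype.card β ^ Fintype.card κ) := by
        rw [hsum]; ring
    _ ≤ (Fintype.card β).factorial *
          (M.card ^ Fintype.card κ * (Fintype.card β).descFactorial (Fintype.card κ)) :=
        Nat.mul_le_mul_left _ (descFactorial_mul_pow_le M.card_le_univ _)
    _ = _ := by ring

/-- An elementary form of Jensen's inequality for `x ↦ ∏ i, (x i)⁻¹`. -/
theorem card_mul_prod_inv_le_sum_prod_inv {Ω ι : Type*} [Fintype Ω] [Fintype ι]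
    (c : Ω → ι → ℝ) (B : ι → ℝ) (hc : ∀ ω i, 0 < c ω i) (hB : ∀ i, 0 < B i)
    (h : ∀ i, ∑ ω, c ω i ≤ Fintype.card Ω * B i) :
    Fintype.card Ω * ∏ i, (B i)⁻¹ ≤ ∑ ω, ∏ i, (c ω i)⁻¹ := by
  -- With `x_i = c ω i / B i`, two uses of `1 + y ≤ exp y` give `∏ x_i⁻¹ ≥ exp (-∑ (x_i - 1)) ≥ 1 -
  -- ∑ (x_i - 1)`. Averaged over `ω`, the last sum is nonpositive.
  have h1 : ∀ ω, (1 - ∑ i, (c ω i / B i - 1)) * ∏ i, (B i)⁻¹ ≤ ∏ i, (c ω i)⁻¹ := by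
    intro ω
    have e : ∏ i, (c ω i)⁻¹ = (∏ i, (c ω i / B i)⁻¹) * ∏ i, (B i)⁻¹ := by
      rw [← Finset.prod_mul_distrib]
      refine Finset.prod_congr rfl fun i _ => ?_
      have := (hc ω i).ne'
      have := (hB i).ne'
      field_simp
    rw [e]
    refine mul_le_mul_of_nonneg_right ?_ (Finset.prod_nonneg fun i _ => (inv_pos.2 (hB i)).le)
    calc 1 - ∑ i, (c ω i / B i - 1) ≤ Real.exp (-∑ i, (c ω i / B i - 1)) := by
          linarith [Real.add_one_le_exp (-∑ i, (c ω i / B i - 1))]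
      _ = ∏ i, (Real.exp (c ω i / B i - 1))⁻¹ := by
          simp_rw [← Real.exp_neg]
          rw [← Real.exp_sum, Finset.sum_neg_distrib]
      _ ≤ ∏ i, (c ω i / B i)⁻¹ := by
          refine Finset.prod_le_prod (fun i _ => by positivity) fun i _ => ?_
          refine inv_anti₀ (div_pos (hc ω i) (hB i)) ?_
          linarith [Real.add_one_le_exp (c ω i / B i - 1)]
  refine le_trans ?_ (Finset.sum_le_sum fun ω _ => h1 ω)
  rw [← Finset.sum_mul]
  refine mul_le_mul_of_nonneg_right ?_ (Finset.prod_nonneg fun i _ => (inv_pos.2 (hB i)).le)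
  rw [Finset.sum_sub_distrib, Finset.sum_comm]
  have h2 : ∑ i, ∑ ω, (c ω i / B i - 1) ≤ 0 := by
    refine Finset.sum_nonpos fun i _ => ?_
    rw [Finset.sum_sub_distrib, ← Finset.sum_div]
    have := (div_le_iff₀ (hB i)).2 (h i)
    simpa using this
  simpa using h2

/-! ### Blocks and pairs in a Steiner triple system -/

namespace IsSteinerTripleSystem

variable {V : Type*} [DecidableEq V] {T : Finset (Finset V)}

theorem card_inter_le_one (hT : IsSteinerTripleSystem T) {s t : Finset V} (hs : s ∈ T)
    (ht : t ∈ T) (hst : s ≠ t) : (s ∩ t).card ≤ 1 := by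
  by_contra hlt
  obtain ⟨x, hx, y, hy, hxy⟩ := Finset.one_lt_card.1 (not_le.1 hlt)
  rw [Finset.mem_inter] at hx hy
  exact hst ((hT.2 x y hxy).unique ⟨hs, hx.1, hy.1⟩ ⟨ht, hx.2, hy.2⟩)

theorem card_mul_six [Fintype V] (hT : IsSteinerTripleSystem T) :
    T.card * 6 = Fintype.card V * (Fintype.card V - 1) := by
  have h1 : T.biUnion Finset.offDiag = (Finset.univ : Finset V).offDiag := by
    ext ⟨x, y⟩
    simp only [Finset.mem_biUnion, Finset.mem_offDiag, Finset.mem_univ, true_and]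
    constructor
    · rintro ⟨t, _, _, _, h⟩
      exact h
    · intro h
      obtain ⟨t, ⟨ht, hx, hy⟩, _⟩ := hT.2 x y h
      exact ⟨t, ht, hx, hy, h⟩
  have h2 : (T.biUnion Finset.offDiag).card = ∑ t ∈ T, t.offDiag.card := by
    refine Finset.card_biUnion fun s hs t ht hst => ?_
    refine Finset.disjoint_left.2 ?_
    rintro ⟨x, y⟩ hx hy
    rw [Finset.mem_offDiag] at hx hy
    exact hst ((hT.2 x y hx.2.2).unique ⟨hs, hx.1, hx.2.1⟩ ⟨ht, hy.1, hy.2.1⟩)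
  rw [h1, Finset.sum_congr rfl fun t ht => by rw [Finset.offDiag_card, hT.1 t ht],
    Finset.offDiag_card, Finset.sum_const, Finset.card_univ, smul_eq_mul] at h2
  rw [Nat.mul_sub, mul_one, h2]

/-- Take the blocks through the three pairs of `t`. If two of them coincided, that block would
contain all of `t`, hence equal it. -/
theorem exists_embedding_of_notMem (hT : IsSteinerTripleSystem T) {t : Finset V}
    (ht : t.card = 3) (htT : t ∉ T) : ∃ f : Fin 3 ↪ T, ∀ k, 1 < (t ∩ (f k).1).card := by
  obtain ⟨x, y, z, hxy, hxz, hyz, rfl⟩ := Finset.card_eq_three.1 ht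
  obtain ⟨a, ⟨haT, hax, hay⟩, _⟩ := hT.2 x y hxy
  obtain ⟨b, ⟨hbT, hbx, hbz⟩, _⟩ := hT.2 x z hxz
  obtain ⟨c, ⟨hcT, hcy, hcz⟩, _⟩ := hT.2 y z hyz
  have key : ∀ d ∈ T, x ∈ d → y ∈ d → z ∈ d → False := by
    intro d hd hx hy hz
    have hsub : ({x, y, z} : Finset V) ⊆ d := by
      intro w hw
      simp only [Finset.mem_insert, Finset.mem_singleton] at hw
      rcases hw with rfl | rfl | rfl <;> assumption
    rw [Finset.eq_of_subset_of_card_le hsub (by rw [ht, hT.1 d hd])] at htT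
    exact htT hd
  have hab : a ≠ b := fun h => key a haT hax hay (h ▸ hbz)
  have hac : a ≠ c := fun h => key a haT hax hay (h ▸ hcz)
  have hbc : b ≠ c := fun h => key b hbT hbx (h ▸ hcy) hbz
  refine ⟨⟨![⟨a, haT⟩, ⟨b, hbT⟩, ⟨c, hcT⟩], ?_⟩, ?_⟩
  · intro i j h
    fin_cases i <;> fin_cases j <;> first
      | rfl
      | exact absurd (congrArg Subtype.val h) hab
      | exact absurd (congrArg Subtype.val h) hac
      | exact absurd (congrArg Subtype.val h) hbc
      | exact absurd (congrArg Subtype.val h) hab.symm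
      | exact absurd (congrArg Subtype.val h) hac.symm
      | exact absurd (congrArg Subtype.val h) hbc.symm
  · intro k
    rw [Finset.one_lt_card]
    fin_cases k
    · exact ⟨x, Finset.mem_inter.2 ⟨by simp, hax⟩, y, Finset.mem_inter.2 ⟨by simp, hay⟩, hxy⟩
    · exact ⟨x, Finset.mem_inter.2 ⟨by simp, hbx⟩, z, Finset.mem_inter.2 ⟨by simp, hbz⟩, hxz⟩
    · exact ⟨y, Finset.mem_inter.2 ⟨by simp, hcy⟩, z, Finset.mem_inter.2 ⟨by simp, hcz⟩, hyz⟩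

end IsSteinerTripleSystem

/-! ### Available triples under a random ordering -/

/-- The triples that meet every member of `R` in at most one vertex. -/
def availableTriples {V : Type*} [Fintype V] [DecidableEq V] (R : Finset (Finset V)) :
    Finset (Finset V) :=
  ((Finset.univ : Finset V).powersetCard 3).filter fun t => ∀ r ∈ R, (t ∩ r).card ≤ 1

namespace IsSteinerTripleSystem

variable {V : Type*} [Fintype V] [DecidableEq V] {T : Finset (Finset V)}

/-- Any block sharing a pair with `t` blocks it once placed, so all the `f k` must occupy the last
`N - i` positions. Used with one block when `t ∈ T` and with three otherwise. -/
theorem card_available_mul_pow_le {N : ℕ} (hN : T.card = N) (i : Fin N) {κ : Type*} [Fintype κ]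
    {t : Finset V} (f : κ ↪ T) (hf : ∀ k, 1 < (t ∩ (f k).1).card) :
    (Finset.univ.filter fun σ : T ≃ Fin N => t ∈ availableTriples
        ((Finset.Iio i).image fun j => (σ.symm j : Finset V))).card * N ^ Fintype.card κ ≤
      N.factorial * (N - i) ^ Fintype.card κ := by
  have h := card_equiv_mapsTo_mul_pow_le (by simpa using hN) f (Finset.Ici i)
  rw [Fintype.card_fin, Fin.card_Ici] at h
  refine (Nat.mul_le_mul_right _ (Finset.card_le_card fun σ hσ => ?_)).trans h
  refine Finset.mem_filter.2 ⟨Finset.mem_univ _, fun k => Finset.mem_Ici.2 ?_⟩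
  by_contra hlt
  refine (hf k).not_ge ((Finset.mem_filter.1 (Finset.mem_filter.1 hσ).2).2 _ ?_)
  exact Finset.mem_image.2 ⟨σ (f k), Finset.mem_Iio.2 (not_le.1 hlt), by simp⟩

/-- In a uniformly random ordering of the blocks, the expected number of triples still available
when `m` blocks remain. -/
theorem sum_card_availableTriples_le (hT : IsSteinerTripleSystem T) {N : ℕ} (hN : T.card = N)
    (i : Fin N) :
    ∑ σ : T ≃ Fin N, ((availableTriples
        ((Finset.Iio i).image fun j => (σ.symm j : Finset V))).card : ℝ) ≤
      N.factorial * (((N - i : ℕ) : ℝ) +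
        (Fintype.card V).choose 3 * ((N - i : ℕ) : ℝ) ^ 3 / (N : ℝ) ^ 3) := by
  have hN0 : (0 : ℝ) < N := by exact_mod_cast i.pos
  set c : Finset V → ℕ := fun t => (Finset.univ.filter fun σ : T ≃ Fin N => t ∈ availableTriples
        ((Finset.Iio i).image fun j => (σ.symm j : Finset V))).card with hc
  set P := (Finset.univ : Finset V).powersetCard 3 with hP
  have hTP : T ⊆ P := fun t ht =>
    Finset.mem_powersetCard.2 ⟨Finset.subset_univ _, hT.1 t ht⟩
  have hmem : ∀ t ∈ T, (c t : ℝ) ≤ N.factorial * ((N - i : ℕ) : ℝ) / N := by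
    intro t ht
    rw [le_div_iff₀ hN0]
    have h := card_available_mul_pow_le hN i (t := t)
      (⟨fun _ : Fin 1 => (⟨t, ht⟩ : T), fun _ _ _ => Subsingleton.elim _ _⟩ : Fin 1 ↪ T)
      (fun _ => by
        change 1 < (t ∩ t).card
        rw [Finset.inter_self, hT.1 t ht]
        norm_num)
    rw [Fintype.card_fin, pow_one, pow_one] at h
    exact_mod_cast h
  have hnot : ∀ t ∈ P \ T, (c t : ℝ) ≤ N.factorial * ((N - i : ℕ) : ℝ) ^ 3 / (N : ℝ) ^ 3 := by
    intro t ht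
    rw [Finset.mem_sdiff, Finset.mem_powersetCard] at ht
    obtain ⟨f, hf⟩ := hT.exists_embedding_of_notMem ht.1.2 ht.2
    have h := card_available_mul_pow_le hN i f hf
    rw [Fintype.card_fin] at h
    rw [le_div_iff₀ (by positivity)]
    exact_mod_cast h
  have hswap : ∑ σ : T ≃ Fin N, ((availableTriples
        ((Finset.Iio i).image fun j => (σ.symm j : Finset V))).card : ℝ) = ∑ t ∈ P, (c t : ℝ) := by
    have h1 : ∀ R : Finset (Finset V), (availableTriples R).card =
        ∑ t ∈ P, if t ∈ availableTriples R then 1 else 0 := by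
      intro R
      rw [← Finset.card_filter, Finset.filter_mem_eq_inter,
        Finset.inter_eq_right.2 (show availableTriples R ⊆ P from Finset.filter_subset _ _)]
    simp_rw [hc, Finset.card_filter, h1]
    push_cast
    exact Finset.sum_comm
  rw [hswap, ← Finset.sum_sdiff hTP]
  have e1 := Finset.sum_le_card_nsmul T (fun t => (c t : ℝ)) _ hmem
  have e2 := Finset.sum_le_card_nsmul (P \ T) (fun t => (c t : ℝ)) _ hnot
  have e3 : ((P \ T).card : ℝ) ≤ (Fintype.card V).choose 3 := by
    have := Finset.card_le_card (Finset.sdiff_subset (s := P) (t := T))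
    rw [hP, Finset.card_powersetCard, Finset.card_univ] at this
    exact_mod_cast this
  rw [nsmul_eq_mul, hN] at e1
  rw [nsmul_eq_mul] at e2
  have e4 := mul_le_mul_of_nonneg_right e3
    (show 0 ≤ N.factorial * ((N - i : ℕ) : ℝ) ^ 3 / (N : ℝ) ^ 3 by positivity)
  have e5 : (N : ℝ) * (N.factorial * ((N - i : ℕ) : ℝ) / N) = N.factorial * ((N - i : ℕ) : ℝ) := by
    field_simp
  calc _ ≤ (Fintype.card V).choose 3 * (N.factorial * ((N - i : ℕ) : ℝ) ^ 3 / (N : ℝ) ^ 3) +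
        N.factorial * ((N - i : ℕ) : ℝ) := add_le_add (e2.trans e4) (e1.trans e5.le)
    _ = _ := by ring

theorem mem_availableTriples (hT : IsSteinerTripleSystem T) {N : ℕ} (σ : T ≃ Fin N) (i : Fin N) :
    (σ.symm i : Finset V) ∈ availableTriples
      ((Finset.Iio i).image fun j => (σ.symm j : Finset V)) := by
  refine Finset.mem_filter.2 ⟨Finset.mem_powersetCard.2 ⟨Finset.subset_univ _,
    hT.1 _ (σ.symm i).2⟩, fun r hr => ?_⟩
  obtain ⟨j, hj, rfl⟩ := Finset.mem_image.1 hr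
  refine hT.card_inter_le_one (σ.symm i).2 (σ.symm j).2 fun h => ?_
  exact (Finset.mem_Iio.1 hj).ne' (σ.symm.injective (Subtype.ext h))

end IsSteinerTripleSystem

/-! ### The product bound on the number of systems -/

theorem card_isSteinerTripleSystem_le {V : Type*} [Fintype V] [DecidableEq V] {N : ℕ}
    (hN : N * 6 = Fintype.card V * (Fintype.card V - 1)) :
    (Nat.card {T : Finset (Finset V) // IsSteinerTripleSystem T} : ℝ) ≤
      ∏ i ∈ Finset.range N,
        (1 + (Fintype.card V).choose 3 * ((i : ℝ) + 1) ^ 2 / (N : ℝ) ^ 3) := by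
  classical
  have hcard : ∀ T : {T : Finset (Finset V) // IsSteinerTripleSystem T}, T.1.card = N := by
    intro T
    have := T.2.card_mul_six
    omega
  set K : ℝ := ((Fintype.card V).choose 3 : ℝ)
  have hK0 : 0 ≤ K := by positivity
  set B : Fin N → ℝ := fun i => ((N - i : ℕ) : ℝ) + K * ((N - i : ℕ) : ℝ) ^ 3 / (N : ℝ) ^ 3 with hB
  have hBpos : ∀ i, 0 < B i := by
    intro i
    have : (0 : ℝ) < ((N - i : ℕ) : ℝ) := by exact_mod_cast Nat.sub_pos_of_lt i.2
    positivity
  -- The uniform distribution on the triples available after `R`, or zero if there are none.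
  set g : Finset (Finset V) → Finset V → ℝ := fun R t =>
    if t ∈ availableTriples R then ((availableTriples R).card : ℝ)⁻¹ else 0 with hg
  have hg0 : ∀ R t, 0 ≤ g R t := by
    intro R t
    simp only [hg]
    split_ifs <;> positivity
  have hg1 : ∀ R, ∑ t, g R t ≤ 1 := by
    intro R
    simp only [hg]
    rw [← Finset.sum_filter, Finset.sum_const, Finset.filter_mem_eq_inter, Finset.univ_inter,
      nsmul_eq_mul]
    exact mul_inv_le_one
  let Φ : (Σ T : {T : Finset (Finset V) // IsSteinerTripleSystem T}, (T.1 ≃ Fin N)) →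
      Fin N → Finset V := fun x i => x.2.symm i
  -- The sequence of blocks determines `T` as its range, and then the ordering.
  have hΦ : Function.Injective Φ := by
    rintro ⟨⟨T, hT⟩, σ⟩ ⟨⟨T', hT'⟩, σ'⟩ h
    have himg : ∀ (T : {T : Finset (Finset V) // IsSteinerTripleSystem T}) (σ : T.1 ≃ Fin N),
        T.1 = Finset.univ.image (Φ ⟨T, σ⟩) := by
      intro T σ
      ext t
      simp only [Finset.mem_image, Finset.mem_univ, true_and]
      constructor
      · intro ht
        exact ⟨σ ⟨t, ht⟩, by simp [Φ]⟩
      · rintro ⟨j, rfl⟩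
        exact (σ.symm j).2
    have hTT : T = T' := by
      refine (himg ⟨T, hT⟩ σ).trans ?_
      rw [h]
      exact (himg ⟨T', hT'⟩ σ').symm
    subst hTT
    have : σ = σ' := by
      apply Equiv.symm_bijective.injective
      ext1 j
      exact Subtype.ext (congrFun h j)
    rw [this]
  have hkraft := sum_prod_prefix_weight_le_one g hg0 hg1 N
  have hsub : ∑ x, ∏ i, g ((Finset.Iio i).image (Φ x)) (Φ x i) ≤ 1 := by
    rw [← Finset.sum_image (f := fun s : Fin N → Finset V =>
      ∏ i, g ((Finset.Iio i).image s) (s i)) (g := Φ) hΦ.injOn]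
    exact (Finset.sum_le_univ_sum_of_nonneg fun s =>
      Finset.prod_nonneg fun i _ => hg0 _ _).trans hkraft
  have hT : ∀ T : {T : Finset (Finset V) // IsSteinerTripleSystem T},
      N.factorial * ∏ i, (B i)⁻¹ ≤
        ∑ σ : T.1 ≃ Fin N, ∏ i, g ((Finset.Iio i).image (Φ ⟨T, σ⟩)) (Φ ⟨T, σ⟩ i) := by
    intro T
    have hcardσ : Fintype.card (T.1 ≃ Fin N) = N.factorial := by
      rw [Fintype.card_equiv (Fintype.equivOfCardEq (by simpa using hcard T)), Fintype.card_coe,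
        hcard T]
    rw [← hcardσ]
    refine (card_mul_prod_inv_le_sum_prod_inv (fun (σ : T.1 ≃ Fin N) (i : Fin N) =>
      ((availableTriples ((Finset.Iio i).image (Φ ⟨T, σ⟩))).card : ℝ)) B ?_ hBpos ?_).trans ?_
    · intro σ i
      exact_mod_cast Finset.card_pos.2 ⟨_, T.2.mem_availableTriples σ i⟩
    · intro i
      rw [hcardσ]
      exact T.2.sum_card_availableTriples_le (hcard T) i
    · refine Finset.sum_le_sum fun σ _ => Finset.prod_le_prod (fun i _ => by positivity)
        fun i _ => ?_
      simp only [hg]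
      rw [if_pos (T.2.mem_availableTriples σ i)]
  rw [Fintype.sum_sigma] at hsub
  have h1 := (Finset.sum_le_sum fun T _ => hT T).trans hsub
  rw [Finset.sum_const, Finset.card_univ, nsmul_eq_mul, Finset.prod_inv_distrib, ← mul_assoc,
    ← div_eq_mul_inv, div_le_one (Finset.prod_pos fun i _ => hBpos i)] at h1
  -- Reversing the index gives `m = i + 1`. Each `B` factors as `m (1 + K m^2 / N^3)`, and the
  -- product of the `m` cancels the number of orderings.
  have h2 : ∏ i, B i = N.factorial *
      ∏ i ∈ Finset.range N, (1 + K * ((i : ℝ) + 1) ^ 2 / (N : ℝ) ^ 3) := by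
    rw [Fin.prod_univ_eq_prod_range (fun i : ℕ => ((N - i : ℕ) : ℝ) +
      K * ((N - i : ℕ) : ℝ) ^ 3 / (N : ℝ) ^ 3) N, ← Finset.prod_range_reflect,
      ← Finset.prod_range_add_one_eq_factorial, Nat.cast_prod, ← Finset.prod_mul_distrib]
    refine Finset.prod_congr rfl fun i hi => ?_
    have : N - (N - 1 - i) = i + 1 := by
      have := Finset.mem_range.1 hi
      omega
    rw [this]
    push_cast
    ring
  rw [h2, mul_comm] at h1
  rw [Nat.card_eq_fintype_card]
  exact le_of_mul_le_mul_left h1 (by positivity)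

/-! ### Asymptotics of the product -/

theorem log_factorial_le (N : ℕ) (hN : N ≠ 0) :
    Real.log (N.factorial : ℝ) ≤ N * Real.log N - N + 1 + Real.log N := by
  induction N with
  | zero => exact absurd rfl hN
  | succ N ih =>
    rcases Nat.eq_zero_or_pos N with rfl | hpos
    · simp
    have hN0 : (0 : ℝ) < N := by exact_mod_cast hpos
    have ih := ih hpos.ne'
    rw [Nat.factorial_succ, Nat.cast_mul, Real.log_mul (by positivity) (by positivity)]
    push_cast
    have h : 1 / ((N : ℝ) + 1) ≤ Real.log (N + 1) - Real.log N := by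
      have h1 := Real.add_one_le_exp (Real.log N - Real.log (N + 1))
      have h2 : Real.exp (Real.log N - Real.log (N + 1)) = N / (N + 1) := by
        rw [Real.exp_sub, Real.exp_log hN0, Real.exp_log (by positivity)]
      rw [h2] at h1
      have h3 : (N : ℝ) / (N + 1) = 1 - 1 / (N + 1) := by field_simp; ring
      linarith
    have h4 : 1 ≤ (N + 1) * (Real.log (N + 1) - Real.log N) := by
      rw [div_le_iff₀ (by positivity)] at h
      linarith
    nlinarith

/-- Follows from `1 + u^2 ≤ (u + 1)^2`. For `u = √n (i + 1) / N` the main term sums to a factorial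
and the error `2 / u` to a harmonic sum, of total order `N log N / √n`. -/
theorem log_one_add_sq_le {u : ℝ} (hu : 0 < u) :
    Real.log (1 + u ^ 2) ≤ 2 * Real.log u + 2 / u := by
  have h1 : 1 + u ^ 2 ≤ (u * (1 + 1 / u)) ^ 2 := by
    have : u * (1 + 1 / u) = u + 1 := by field_simp
    rw [this]
    nlinarith
  calc Real.log (1 + u ^ 2) ≤ Real.log ((u * (1 + 1 / u)) ^ 2) :=
        Real.log_le_log (by positivity) h1
    _ = 2 * (Real.log u + Real.log (1 + 1 / u)) := by
        rw [Real.log_pow, Real.log_mul (by positivity) (by positivity)]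
        norm_num
    _ ≤ 2 * (Real.log u + 1 / u) := by
        have := Real.log_le_sub_one_of_pos (show 0 < 1 + 1 / u by positivity)
        linarith
    _ = _ := by ring

theorem sum_log_one_add_le {n N : ℕ} (hn : n ≠ 0) (hN : N ≠ 0) :
    ∑ i ∈ Finset.range N, Real.log (1 + (n : ℝ) * ((i : ℝ) + 1) ^ 2 / (N : ℝ) ^ 2) ≤
      N * (Real.log n - 2) + 2 + 2 * Real.log N + 2 * N / √n * (1 + Real.log N) := by
  have hn0 : (0 : ℝ) < n := by positivity
  have hN0 : (0 : ℝ) < N := by positivity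
  have hs : (0 : ℝ) < √n := Real.sqrt_pos.2 hn0
  have h1 : ∀ i ∈ Finset.range N, Real.log (1 + (n : ℝ) * ((i : ℝ) + 1) ^ 2 / (N : ℝ) ^ 2) ≤
      (Real.log n - 2 * Real.log N) + 2 * Real.log ((i : ℝ) + 1) +
        2 * N / √n * ((i : ℝ) + 1)⁻¹ := by
    intro i _
    have hi : (0 : ℝ) < (i : ℝ) + 1 := by positivity
    have h := log_one_add_sq_le (show 0 < √n * ((i : ℝ) + 1) / N by positivity)
    have e : (√n * ((i : ℝ) + 1) / N) ^ 2 = (n : ℝ) * ((i : ℝ) + 1) ^ 2 / (N : ℝ) ^ 2 := by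
      rw [div_pow, mul_pow, Real.sq_sqrt hn0.le]
    have e2 : 2 / (√n * ((i : ℝ) + 1) / N) = 2 * N / √n * ((i : ℝ) + 1)⁻¹ := by
      field_simp
    rw [e, e2, Real.log_div (by positivity) hN0.ne', Real.log_mul hs.ne' hi.ne',
      Real.log_sqrt hn0.le] at h
    linarith
  refine (Finset.sum_le_sum h1).trans ?_
  rw [Finset.sum_add_distrib, Finset.sum_add_distrib, Finset.sum_const, Finset.card_range,
    ← Finset.mul_sum, ← Finset.mul_sum, nsmul_eq_mul]
  have h2 : ∑ i ∈ Finset.range N, Real.log ((i : ℝ) + 1) = Real.log (N.factorial : ℝ) := by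
    rw [← Finset.prod_range_add_one_eq_factorial, Nat.cast_prod, Real.log_prod]
    · simp
    · intro i _
      positivity
  have h3 : ∑ i ∈ Finset.range N, ((i : ℝ) + 1)⁻¹ ≤ 1 + Real.log N := by
    have := harmonic_le_one_add_log N
    simpa [harmonic] using this
  have h4 := mul_le_mul_of_nonneg_left h3 (show 0 ≤ 2 * N / √n by positivity)
  rw [h2]
  have := log_factorial_le N hN
  linarith

theorem log_STS_le {n : ℕ} (hn : n ≠ 0) (hpos : 0 < STS n) :
    Real.log (STS n) ≤ (n : ℝ) ^ 2 / 6 * (Real.log n - 2 +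
      (2 / n + 12 / (n : ℝ) ^ 2 * (1 + 2 * Real.log n) + 2 / √n * (1 + 2 * Real.log n))) := by
  have hn0 : (0 : ℝ) < n := by positivity
  have hn1 : (1 : ℝ) ≤ n := by exact_mod_cast Nat.one_le_iff_ne_zero.2 hn
  have hL : 0 ≤ Real.log n := Real.log_nonneg hn1
  have hs : (0 : ℝ) < √n := Real.sqrt_pos.2 hn0
  obtain ⟨⟨T, hT⟩⟩ := (Nat.card_pos_iff.1 hpos).1
  have hN := hT.card_mul_six
  have hbound := card_isSteinerTripleSystem_le hN
  set N := T.card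
  rw [Fintype.card_fin] at hN hbound
  change (STS n : ℝ) ≤ _ at hbound
  have hNR : (N : ℝ) = ((n : ℝ) ^ 2 - n) / 6 := by
    have : (N : ℝ) * 6 = n * (n - 1) := by
      rw [← Nat.cast_pred (Nat.pos_of_ne_zero hn)]
      exact_mod_cast hN
    linarith
  -- The error term `2 / n` pays for replacing `N` by `n^2 / 6` in front of `-2`.
  have hsplit : (n : ℝ) ^ 2 / 6 * (Real.log n - 2 +
      (2 / n + 12 / (n : ℝ) ^ 2 * (1 + 2 * Real.log n) + 2 / √n * (1 + 2 * Real.log n))) =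
      N * (Real.log n - 2) + n / 6 * Real.log n + 2 * (1 + 2 * Real.log n) +
        (n : ℝ) ^ 2 / 6 * (2 / √n * (1 + 2 * Real.log n)) := by
    rw [hNR]
    field_simp
    ring
  rw [hsplit]
  rcases Nat.eq_zero_or_pos N with h0 | hNpos
  · rw [h0, Finset.prod_range_zero] at hbound
    have h1 : Real.log (STS n) ≤ 0 := Real.log_nonpos (by positivity) hbound
    rw [h0]
    push_cast
    rw [zero_mul, zero_add]
    exact h1.trans (by positivity)
  have hN0 : (0 : ℝ) < N := by exact_mod_cast hNpos
  have hchoose : (n.choose 3 : ℝ) ≤ n * N := by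
    have h1 : n.choose 3 * 6 = n.descFactorial 3 := by
      rw [Nat.descFactorial_eq_factorial_mul_choose, mul_comm]
      rfl
    have h2 : n.descFactorial 3 ≤ n * (n * (n - 1)) := by
      simp only [Nat.descFactorial_succ, Nat.descFactorial_zero, mul_one, Nat.sub_zero]
      rw [mul_comm (n - 1) n]
      exact Nat.mul_le_mul_right _ (Nat.sub_le n 2)
    have h3 : n.choose 3 ≤ n * N := by
      rw [← hN, ← mul_assoc, ← h1] at h2
      omega
    exact_mod_cast h3
  have hprod : (STS n : ℝ) ≤ ∏ i ∈ Finset.range N,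
      (1 + (n : ℝ) * ((i : ℝ) + 1) ^ 2 / (N : ℝ) ^ 2) := by
    refine hbound.trans (Finset.prod_le_prod (fun i _ => by positivity) fun i _ => ?_)
    have e : (n : ℝ) * ((i : ℝ) + 1) ^ 2 / (N : ℝ) ^ 2 =
        (n * N) * ((i : ℝ) + 1) ^ 2 / (N : ℝ) ^ 3 := by
      field_simp
    rw [e]
    gcongr
  have hlog := Real.log_le_log (by exact_mod_cast hpos) hprod
  rw [Real.log_prod (fun i _ => by positivity)] at hlog
  have hfin := hlog.trans (sum_log_one_add_le hn hNpos.ne')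
  have hNn : (N : ℝ) ≤ (n : ℝ) ^ 2 / 6 := by rw [hNR]; linarith
  have hlogN : Real.log N ≤ 2 * Real.log n := by
    have : Real.log N ≤ Real.log ((n : ℝ) ^ 2) :=
      Real.log_le_log hN0 (hNn.trans (by nlinarith [sq_nonneg (n : ℝ)]))
    rwa [Real.log_pow] at this
  have hlast : 2 * N / √n * (1 + Real.log N) ≤
      (n : ℝ) ^ 2 / 6 * (2 / √n * (1 + 2 * Real.log n)) := by
    have hlN : 0 ≤ Real.log N := Real.log_nonneg (by exact_mod_cast hNpos)
    calc 2 * N / √n * (1 + Real.log N) = N * (2 / √n * (1 + Real.log N)) := by ring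
      _ ≤ _ := by gcongr
  have : 0 ≤ n / 6 * Real.log n := by positivity
  linarith

theorem tendsto_STS_error :
    Tendsto (fun n : ℕ => 2 / (n : ℝ) + 12 / (n : ℝ) ^ 2 * (1 + 2 * Real.log n) +
      2 / √n * (1 + 2 * Real.log n)) atTop (𝓝 0) := by
  have hx : Tendsto (fun x : ℝ => 2 / x + 12 / x ^ 2 * (1 + 2 * Real.log x) +
      2 / √x * (1 + 2 * Real.log x)) atTop (𝓝 0) := by
    have hl : ∀ r : ℝ, 0 < r → Tendsto (fun x : ℝ => Real.log x / x ^ r) atTop (𝓝 0) :=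
      fun r hr => (isLittleO_log_rpow_atTop hr).tendsto_div_nhds_zero
    have hi : ∀ r : ℝ, 0 < r → Tendsto (fun x : ℝ => x ^ (-r)) atTop (𝓝 0) :=
      fun r hr => tendsto_rpow_neg_atTop hr
    have h := (((hi 1 one_pos).const_mul 2).add (((hi 2 two_pos).const_mul 12).add
      ((hl 2 two_pos).const_mul 24))).add (((hi (1 / 2) one_half_pos).const_mul 2).add
      ((hl (1 / 2) one_half_pos).const_mul 4))
    simp only [mul_zero, add_zero] at h
    refine h.congr' ?_
    filter_upwards [eventually_gt_atTop 0] with x hx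
    rw [Real.rpow_neg hx.le, Real.rpow_neg hx.le, Real.rpow_neg hx.le, Real.rpow_one,
      Real.rpow_two, ← Real.sqrt_eq_rpow]
    ring
  exact hx.comp tendsto_natCast_atTop_atTop

theorem theorem1 :
    ∃ ε : ℕ → ℝ, Tendsto ε atTop (𝓝 0) ∧ ∀ n : ℕ, 0 < 1 + ε n ∧
      (STS n : ℝ) ≤ ((1 + ε n) * ((n : ℝ) / Real.exp 2)) ^ ((n : ℝ) ^ 2 / 6) := by
  set δ : ℕ → ℝ := fun n => 2 / (n : ℝ) + 12 / (n : ℝ) ^ 2 * (1 + 2 * Real.log n) +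
      2 / √n * (1 + 2 * Real.log n)
  refine ⟨fun n => Real.exp (δ n) - 1, ?_, fun n => ⟨?_, ?_⟩⟩
  · have := ((Real.continuous_exp.tendsto 0).comp tendsto_STS_error).sub_const 1
    simpa using this
  · simpa using Real.exp_pos _
  · rw [add_sub_cancel]
    rcases Nat.eq_zero_or_pos (STS n) with h0 | hpos
    · rw [h0, Nat.cast_zero]
      positivity
    -- For `n = 0` the right side is `0 ^ 0 = 1`; taking `log n` below needs `n > 0`.
    rcases Nat.eq_zero_or_pos n with rfl | hn
    · have h := card_isSteinerTripleSystem_le (V := Fin 0) (N := 0) (by simp)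
      rw [Finset.prod_range_zero] at h
      change (STS 0 : ℝ) ≤ 1 at h
      simpa using h
    have hn0 : (0 : ℝ) < n := by exact_mod_cast hn
    have hbase : Real.exp (δ n) * ((n : ℝ) / Real.exp 2) =
        Real.exp (Real.log n - 2 + δ n) := by
      rw [Real.exp_add _ (δ n), Real.exp_sub, Real.exp_log hn0]
      ring
    rw [hbase, ← Real.exp_mul, ← Real.log_le_iff_le_exp (by exact_mod_cast hpos), mul_comm]
    exact log_STS_le hn.ne' hpos
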